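/- For a finite point set $S\subset\mathbb{R}^2$, an \emph{acute triangle of minimum area determined by $S$} is a nondegenerate triangle with vertices in $S$ all of whose angles are smaller than $\pi/2$ and whose area is minimum among all nondegenerate triangles with vertices in $S$. The maximum number of acute triangles of minimum area determined by $n$ points in the plane is $O(n)$, and this bound is asymptotically tight. That is, there is a constant $C$ such that every finite set $S$ of points in the plane determines at most $C\,|S|$ acute triangles of minimum area, and there is a constant $c>0$ such that for every $n\ge 3$ some set of $n$ points in the plane determines at least $c\,n$ acute triangles of minimum area. Moreover, for every finite $S\subset\mathbb{R}^2$, the graph with vertex set $S$ in which $u,v\in S$ are adjacent if and only if $uv$ is a shortest side of some acute triangle of minimum area determined by $S$ is a planar straight-line graph: when its edges are drawn as straight segments, no edge contains a vertex other than its endpoints, and any two distinct edges meet at most in a common endpoint. -/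

import Mathlib

/-- The Euclidean plane. -/
abbrev Plane : Type := EuclideanSpace ℝ (Fin 2)

/-- The area of a (nondegenerate) triangle in the plane, by the shoelace formula. -/
noncomputable def triangleArea (t : Affine.Triangle ℝ Plane) : ℝ :=
  |(t.points 1 0 - t.points 0 0) * (t.points 2 1 - t.points 0 1)
    - (t.points 2 0 - t.points 0 0) * (t.points 1 1 - t.points 0 1)| / 2

/-- The nondegenerate triangle `t` is determined (spanned) by the point set `S`:
its three vertices belong to `S`. -/
def SpannedBy (S : Finset Plane) (t : Affine.Triangle ℝ Plane) : Prop :=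
  ∀ i, t.points i ∈ S

/-- `t` is an acute triangle of minimum area determined by `S`: it is spanned by `S`, it is acute,
and its area is minimum among *all* nondegenerate triangles spanned by `S`. -/
def IsAcuteMinTriangle (S : Finset Plane) (t : Affine.Triangle ℝ Plane) : Prop :=
  SpannedBy S t ∧ t.AcuteAngled ∧
    ∀ t' : Affine.Triangle ℝ Plane, SpannedBy S t' → triangleArea t ≤ triangleArea t'

/-- The acute triangles of minimum area determined by `S`, each identified with its set of three
vertices (so that relabelling the vertices does not produce a new triangle). -/
def acuteMinTriangles (S : Finset Plane) : Set (Finset Plane) :=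
  {V | ∃ t : Affine.Triangle ℝ Plane, IsAcuteMinTriangle S t ∧ (V : Set Plane) = Set.range t.points}

/-- The graph of shortest sides: its vertex set is `S`, and `uv` is an edge if and only if the
segment `uv` is a shortest side of an acute triangle of minimum area determined by `S`. -/
def shortestSideGraph (S : Finset Plane) : SimpleGraph S where
  Adj u v := u ≠ v ∧ ∃ t : Affine.Triangle ℝ Plane, IsAcuteMinTriangle S t ∧
    (u : Plane) ∈ Set.range t.points ∧ (v : Plane) ∈ Set.range t.points ∧
    ∀ i j, i ≠ j → dist (u : Plane) v ≤ dist (t.points i) (t.points j)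
  symm := ⟨fun u v h => ⟨h.1.symm, h.2.imp fun t ht =>
    ⟨ht.1, ht.2.2.1, ht.2.1, fun i j hij => dist_comm (u : Plane) v ▸ ht.2.2.2 i j hij⟩⟩⟩
  loopless := ⟨fun _ h => h.1 rfl⟩

/-- A graph on a finite set of points of the plane is a planar straight-line graph: when every edge
is drawn as the straight segment between its endpoints, no segment passes through a vertex other
than its endpoints, and two distinct edges meet at most at a common endpoint. -/
def IsPlanarStraightLineGraph {S : Finset Plane} (G : SimpleGraph S) : Prop :=
  (∀ u v w : S, G.Adj u v → (w : Plane) ∈ segment ℝ (u : Plane) v → w = u ∨ w = v) ∧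
  ∀ u v x y : S, G.Adj u v → G.Adj x y → s(u, v) ≠ s(x, y) →
    segment ℝ (u : Plane) v ∩ segment ℝ (x : Plane) y ⊆
      ({(u : Plane), (v : Plane)} ∩ {(x : Plane), (y : Plane)} : Set Plane)

/-! Let `D` be twice the minimum area. If `uv` is a shortest side of an acute minimum triangle, the
height over it is at least `√3 / 2` times its length, so `|uv|² ≤ 2D / √3`
(`three_mul_sq_sqDist_le`), while any noncollinear triple of `S` has `|cross| ≥ D`. Shortest sides
are thus too short to come close to each other: a proper crossing would force `|uv||xy| ≥ 2D`
(`endpoint_of_mem_inter`), and an angle of at most `π / 4` at a common endpoint would span a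
triangle smaller than `D` (`right_eq_of_octant`). The first fact gives planarity. The second allows
at most 8 shortest sides at a point, one per octant; each side carries at most one apex on either
side (`apex_eq`), whence `C = 16` without Euler's formula. For the lower bound, consecutive triples
of a lattice zigzag are acute of minimum area. -/

open EuclideanGeometry

/-! ### Area, angle and distance in coordinates -/

/-- Twice the signed area of the triangle `pqr`. -/
def cross (p q r : Plane) : ℝ :=
  (q 0 - p 0) * (r 1 - p 1) - (r 0 - p 0) * (q 1 - p 1)

/-- The inner product of `q - p` and `r - p`. -/
def dot (p q r : Plane) : ℝ :=
  (q 0 - p 0) * (r 0 - p 0) + (q 1 - p 1) * (r 1 - p 1)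

/-- The squared distance between `p` and `q`. -/
def sqDist (p q : Plane) : ℝ :=
  (p 0 - q 0) ^ 2 + (p 1 - q 1) ^ 2

lemma plane_ext {p q : Plane} (h0 : p 0 = q 0) (h1 : p 1 = q 1) : p = q := by
  ext i
  fin_cases i
  · exact h0
  · exact h1

lemma dist_eq_sqrt_sqDist (p q : Plane) : dist p q = √(sqDist p q) := by
  rw [EuclideanSpace.dist_eq, Fin.sum_univ_two, Real.dist_eq, Real.dist_eq, sq_abs, sq_abs, sqDist]

lemma sqDist_nonneg (p q : Plane) : 0 ≤ sqDist p q := by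
  unfold sqDist; positivity

lemma dist_le_dist_iff_sqDist {p q r s : Plane} :
    dist p q ≤ dist r s ↔ sqDist p q ≤ sqDist r s := by
  rw [dist_eq_sqrt_sqDist, dist_eq_sqrt_sqDist, Real.sqrt_le_sqrt_iff (sqDist_nonneg _ _)]

lemma sqDist_pos {p q : Plane} (h : p ≠ q) : 0 < sqDist p q := by
  refine lt_of_le_of_ne (sqDist_nonneg p q) fun h0 => h ?_
  unfold sqDist at h0
  refine plane_ext ?_ ?_
  · nlinarith [sq_nonneg (p 0 - q 0), sq_nonneg (p 1 - q 1)]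
  · nlinarith [sq_nonneg (p 0 - q 0), sq_nonneg (p 1 - q 1)]

lemma inner_sub_eq_dot (p q r : Plane) : inner ℝ (q - p) (r - p) = dot p q r := by
  simp only [PiLp.inner_apply, Fin.sum_univ_two, PiLp.sub_apply, dot]
  simp
  ring

lemma angle_lt_pi_div_two_iff_dot {p q r : Plane} : ∠ q p r < Real.pi / 2 ↔ 0 < dot p q r := by
  rw [EuclideanGeometry.angle, InnerProductGeometry.angle, Real.arccos_lt_pi_div_two,
    vsub_eq_sub, vsub_eq_sub, inner_sub_eq_dot]
  refine ⟨fun h => ?_, fun h => ?_⟩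
  · by_contra hd
    exact absurd h (not_lt.mpr (div_nonpos_of_nonpos_of_nonneg (not_lt.mp hd) (by positivity)))
  · have h1 : q - p ≠ 0 := by
      intro h0
      rw [← inner_sub_eq_dot, h0, inner_zero_left] at h
      exact lt_irrefl _ h
    have h2 : r - p ≠ 0 := by
      intro h0
      rw [← inner_sub_eq_dot, h0, inner_zero_right] at h
      exact lt_irrefl _ h
    exact div_pos h (mul_pos (norm_pos_iff.mpr h1) (norm_pos_iff.mpr h2))

lemma exists_param_of_cross_eq_zero {u v x : Plane} (huv : u ≠ v) (h : cross u v x = 0) :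
    ∃ a : ℝ, x 0 = u 0 + a * (v 0 - u 0) ∧ x 1 = u 1 + a * (v 1 - u 1) := by
  have hpos := sqDist_pos huv
  have hne := hpos.ne'
  refine ⟨dot u v x / sqDist u v, ?_, ?_⟩
  · rw [div_mul_eq_mul_div, ← sub_eq_iff_eq_add', eq_div_iff hne]
    unfold cross at h
    unfold sqDist dot
    linear_combination (u 1 - v 1) * h
  · rw [div_mul_eq_mul_div, ← sub_eq_iff_eq_add', eq_div_iff hne]
    unfold cross at h
    unfold sqDist dot
    linear_combination (v 0 - u 0) * h

lemma mem_segment_iff_coord {u v p : Plane} : p ∈ segment ℝ u v ↔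
    ∃ t : ℝ, 0 ≤ t ∧ t ≤ 1 ∧ p 0 = u 0 + t * (v 0 - u 0) ∧ p 1 = u 1 + t * (v 1 - u 1) := by
  rw [segment_eq_image']
  constructor
  · rintro ⟨t, ⟨h0, h1⟩, rfl⟩
    exact ⟨t, h0, h1, by simp, by simp⟩
  · rintro ⟨t, h0, h1, e0, e1⟩
    exact ⟨t, ⟨h0, h1⟩, plane_ext (by simp [e0]) (by simp [e1])⟩

lemma affineIndependent_iff_cross_ne_zero {p q r : Plane} :
    AffineIndependent ℝ ![p, q, r] ↔ cross p q r ≠ 0 := by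
  rw [affineIndependent_iff_not_collinear_set, not_iff_not,
    collinear_iff_of_mem (p₀ := p) (by simp)]
  constructor
  · rintro ⟨v, hv⟩
    obtain ⟨a, ha⟩ := hv q (by simp)
    obtain ⟨b, hb⟩ := hv r (by simp)
    rw [ha, hb]
    simp [cross]
    ring
  · intro h
    by_cases hpq : p = q
    · refine ⟨r - p, fun x hx => ?_⟩
      rcases hx with rfl | rfl | rfl
      · exact ⟨0, by simp⟩
      · exact ⟨0, by simp [hpq]⟩
      · exact ⟨1, by simp⟩
    · refine ⟨q - p, fun x hx => ?_⟩
      rcases hx with rfl | rfl | rfl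
      · exact ⟨0, by simp⟩
      · exact ⟨1, by simp⟩
      · obtain ⟨a, h0, h1⟩ := exists_param_of_cross_eq_zero hpq h
        exact ⟨a, plane_ext (by simp [h0, add_comm]) (by simp [h1, add_comm])⟩

/-! ### Vectors in a common octant -/

/-- A difference of two nonnegative numbers is at most the larger one in absolute value, and the two
orderings bound twice the square of either product by two terms of the expanded right side. -/
lemma two_mul_sq_sub_le {a b c d : ℝ} (ha : 0 ≤ a) (hb : 0 ≤ b) (hc : 0 ≤ c) (hd : 0 ≤ d)
    (hab : a ≤ b) (hcd : c ≤ d) :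
    2 * (a * d - c * b) ^ 2 ≤ (a ^ 2 + b ^ 2) * (c ^ 2 + d ^ 2) := by
  have h1 : |a * d - c * b| ≤ max (a * d) (c * b) :=
    abs_le.mpr ⟨by linarith [le_max_right (a * d) (c * b), mul_nonneg ha hd],
      by linarith [le_max_left (a * d) (c * b), mul_nonneg hc hb]⟩
  have h2 : (a * d - c * b) ^ 2 ≤ max (a * d) (c * b) ^ 2 := by
    rw [← sq_abs]; gcongr
  have ha2 : a ^ 2 ≤ b ^ 2 := by gcongr
  have hc2 : c ^ 2 ≤ d ^ 2 := by gcongr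
  rcases max_cases (a * d) (c * b) with ⟨hm, -⟩ | ⟨hm, -⟩ <;> rw [hm] at h2
  · nlinarith [mul_nonneg (sub_nonneg.mpr ha2) (sq_nonneg d), mul_nonneg (sq_nonneg a) (sq_nonneg c),
      mul_nonneg (sq_nonneg b) (sq_nonneg c)]
  · nlinarith [mul_nonneg (sub_nonneg.mpr hc2) (sq_nonneg b), mul_nonneg (sq_nonneg a) (sq_nonneg c),
      mul_nonneg (sq_nonneg a) (sq_nonneg d)]

/-- Two vectors of the plane in the same octant enclose an angle of at most `π / 4`. -/
lemma two_mul_sq_le_of_octant {a b c d : ℝ} (h0 : 0 ≤ a ↔ 0 ≤ c) (h1 : 0 ≤ b ↔ 0 ≤ d)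
    (h2 : |a| ≤ |b| ↔ |c| ≤ |d|) :
    2 * (a * d - c * b) ^ 2 ≤ (a ^ 2 + b ^ 2) * (c ^ 2 + d ^ 2) := by
  have hac : 0 ≤ a * c := by
    rcases le_or_gt 0 a with h | h
    · exact mul_nonneg h (h0.mp h)
    · exact mul_nonneg_of_nonpos_of_nonpos h.le (not_le.mp (mt h0.mpr h.not_ge)).le
  have hbd : 0 ≤ b * d := by
    rcases le_or_gt 0 b with h | h
    · exact mul_nonneg h (h1.mp h)
    · exact mul_nonneg_of_nonpos_of_nonpos h.le (not_le.mp (mt h1.mpr h.not_ge)).le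
  have hsq : (a * d - c * b) ^ 2 = (|a| * |d| - |c| * |b|) ^ 2 := by
    have e1 : |a| * |c| = a * c := by rw [← abs_mul, abs_of_nonneg hac]
    have e2 : |b| * |d| = b * d := by rw [← abs_mul, abs_of_nonneg hbd]
    have e3 : (|a| * |d| - |c| * |b|) ^ 2 =
        |a| ^ 2 * |d| ^ 2 + |c| ^ 2 * |b| ^ 2 - 2 * (|a| * |c|) * (|b| * |d|) := by ring
    rw [e3, e1, e2, sq_abs, sq_abs, sq_abs, sq_abs]; ring
  rw [hsq, ← sq_abs a, ← sq_abs b, ← sq_abs c, ← sq_abs d]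
  rcases le_or_gt |a| |b| with h | h
  · exact two_mul_sq_sub_le (abs_nonneg _) (abs_nonneg _) (abs_nonneg _) (abs_nonneg _) h (h2.mp h)
  · have h' := (not_le.mp (mt h2.mpr h.not_ge)).le
    have := two_mul_sq_sub_le (abs_nonneg b) (abs_nonneg a) (abs_nonneg d) (abs_nonneg c) h.le h'
    linarith [this, show (|b| * |c| - |d| * |a|) ^ 2 = (|a| * |d| - |c| * |b|) ^ 2 by ring,
      show (|b| ^ 2 + |a| ^ 2) * (|d| ^ 2 + |c| ^ 2) = (|a| ^ 2 + |b| ^ 2) * (|c| ^ 2 + |d| ^ 2)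
        by ring]

/-! ### Geometry of shortest sides -/

/-- The points `u`, `v`, `w` of `S` span an acute triangle of minimum area among the nondegenerate
triangles spanned by `S`, and `uv` is a shortest side of it. -/
structure IsShortBase (S : Finset Plane) (u v w : Plane) : Prop where
  mem_left : u ∈ S
  mem_right : v ∈ S
  mem_apex : w ∈ S
  cross_ne : cross u v w ≠ 0
  dot_left : 0 < dot u v w
  dot_right : 0 < dot v u w
  le_left : sqDist u v ≤ sqDist u w
  le_right : sqDist u v ≤ sqDist v w
  min : ∀ p ∈ S, ∀ q ∈ S, ∀ r ∈ S, cross p q r ≠ 0 → |cross u v w| ≤ |cross p q r|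

lemma abs_cross_points (t : Affine.Triangle ℝ Plane) {i j k : Fin 3} (hij : i ≠ j) (hik : i ≠ k)
    (hjk : j ≠ k) : |cross (t.points i) (t.points j) (t.points k)| = 2 * triangleArea t := by
  have key : cross (t.points i) (t.points j) (t.points k) =
        cross (t.points 0) (t.points 1) (t.points 2) ∨
      cross (t.points i) (t.points j) (t.points k) =
        -cross (t.points 0) (t.points 1) (t.points 2) := by
    fin_cases i <;> fin_cases j <;> fin_cases k <;>
      first
      | exact absurd rfl hij
      | exact absurd rfl hik
      | exact absurd rfl hjk
      | (left; simp only [cross, Fin.zero_eta, Fin.mk_one, Fin.reduceFinMk] <;> ring1)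
      | (right; simp only [cross, Fin.zero_eta, Fin.mk_one, Fin.reduceFinMk]; ring1)
  rw [abs_eq_abs.mpr key, triangleArea, cross]
  ring

lemma triangleArea_pos (t : Affine.Triangle ℝ Plane) : 0 < triangleArea t := by
  have h : AffineIndependent ℝ ![t.points 0, t.points 1, t.points 2] := by
    convert t.independent using 1
    ext i
    fin_cases i <;> rfl
  rw [affineIndependent_iff_cross_ne_zero, ← abs_pos,
    abs_cross_points t (by decide) (by decide) (by decide)] at h
  linarith

lemma IsAcuteMinTriangle.isShortBase {S : Finset Plane} {t : Affine.Triangle ℝ Plane}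
    (ht : IsAcuteMinTriangle S t) {i j k : Fin 3} (hij : i ≠ j) (hik : i ≠ k) (hjk : j ≠ k)
    (hmin : ∀ a b, a ≠ b → dist (t.points i) (t.points j) ≤ dist (t.points a) (t.points b)) :
    IsShortBase S (t.points i) (t.points j) (t.points k) where
  mem_left := ht.1 i
  mem_right := ht.1 j
  mem_apex := ht.1 k
  cross_ne := by
    rw [← abs_pos, abs_cross_points t hij hik hjk]
    linarith [triangleArea_pos t]
  dot_left := angle_lt_pi_div_two_iff_dot.mp (ht.2.1 j i k hij.symm hjk hik)
  dot_right := angle_lt_pi_div_two_iff_dot.mp (ht.2.1 i j k hij hik hjk)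
  le_left := dist_le_dist_iff_sqDist.mp (hmin i k hik)
  le_right := dist_le_dist_iff_sqDist.mp (hmin j k hjk)
  min := by
    intro p hp q hq r hr h
    have h1 := ht.2.2 ⟨![p, q, r], affineIndependent_iff_cross_ne_zero.mpr h⟩ (by
      intro a; fin_cases a
      · exact hp
      · exact hq
      · exact hr)
    have h2 := abs_cross_points ⟨![p, q, r], affineIndependent_iff_cross_ne_zero.mpr h⟩
      (i := 0) (j := 1) (k := 2) (by decide) (by decide) (by decide)
    rw [abs_cross_points t hij hik hjk]
    change |cross p q r| = _ at h2
    linarith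

namespace IsShortBase

variable {S : Finset Plane} {u v w x y z : Plane}

lemma ne (h : IsShortBase S u v w) : u ≠ v := by
  rintro rfl
  exact h.cross_ne (by unfold cross; ring)

lemma abs_cross_eq (h : IsShortBase S u v w) (h' : IsShortBase S x y z) :
    |cross u v w| = |cross x y z| :=
  le_antisymm (h.min _ h'.mem_left _ h'.mem_right _ h'.mem_apex h'.cross_ne)
    (h'.min _ h.mem_left _ h.mem_right _ h.mem_apex h.cross_ne)

lemma sq_cross_eq (h : IsShortBase S u v w) (h' : IsShortBase S x y z) :
    cross u v w ^ 2 = cross x y z ^ 2 :=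
  sq_eq_sq_iff_abs_eq_abs _ _ |>.mpr (h.abs_cross_eq h')

lemma sq_cross_le (h : IsShortBase S u v w) {p q r : Plane} (hp : p ∈ S) (hq : q ∈ S) (hr : r ∈ S)
    (hne : cross p q r ≠ 0) : cross u v w ^ 2 ≤ cross p q r ^ 2 :=
  sq_le_sq.mpr (h.min p hp q hq r hr hne)

lemma dot_lt (h : IsShortBase S u v w) : dot u v w < sqDist u v := by
  have := h.dot_right
  unfold dot at *
  unfold sqDist
  linarith

/-- The height of the triangle over its shortest side is at least `√3 / 2` times that side. -/
lemma three_mul_sq_sqDist_le (h : IsShortBase S u v w) :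
    3 * sqDist u v ^ 2 ≤ 4 * cross u v w ^ 2 := by
  have hd := h.dot_left
  have hA := h.dot_lt
  have hB := h.le_left
  have h2 : 2 * dot u v w ≤ sqDist u w := by
    have := h.le_right
    unfold sqDist at *
    unfold dot
    linarith
  have hL : cross u v w ^ 2 = sqDist u v * sqDist u w - dot u v w ^ 2 := by
    unfold cross sqDist dot; ring
  rw [hL]
  generalize sqDist u v = A at *
  generalize sqDist u w = B at *
  generalize dot u v w = d at *
  -- The value is `A * B - d ^ 2`. If `2 * d ≤ A`, use `A ≤ B`; otherwise use `2 * d ≤ B`, since `d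
  -- * (2 * A - d)` increases in `d` up to `A`.
  rcases le_total (2 * d) A with hc | hc
  · nlinarith
  · nlinarith

/-- A point of `S` at parameter `t` on `uv` cuts off with `w` a triangle of `t` times the minimum
area, so `t` is 0 or 1. -/
lemma eq_or_eq_of_mem_segment (h : IsShortBase S u v w) (hx : x ∈ S) (hs : x ∈ segment ℝ u v) :
    x = u ∨ x = v := by
  obtain ⟨t, h0, h1, e0, e1⟩ := mem_segment_iff_coord.mp hs
  rcases h0.eq_or_lt with rfl | h0
  · exact .inl (plane_ext (by simp [e0]) (by simp [e1]))
  · right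
    have hc : cross u x w = t * cross u v w := by
      unfold cross; rw [e0, e1]; ring
    have hm := h.min u h.mem_left x hx w h.mem_apex
      (by rw [hc]; exact mul_ne_zero h0.ne' h.cross_ne)
    rw [hc, abs_mul, abs_of_pos h0] at hm
    have hp := abs_pos.mpr h.cross_ne
    have ht : t = 1 := by nlinarith
    subst ht
    exact plane_ext (by simp [e0]) (by simp [e1])

/-- Two shortest sides can only meet at an endpoint of one of them. -/
lemma endpoint_of_mem_inter (h : IsShortBase S u v w) (h' : IsShortBase S x y z)
    (hne : s(u, v) ≠ s(x, y)) {p : Plane} (hp : p ∈ segment ℝ u v) (hp' : p ∈ segment ℝ x y) :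
    p = u ∨ p = v ∨ p = x ∨ p = y := by
  by_contra! hcon
  obtain ⟨hpu, hpv, hpx, hpy⟩ := hcon
  obtain ⟨s, s0, s1, e0, e1⟩ := mem_segment_iff_coord.mp hp
  obtain ⟨t, t0, t1, f0, f1⟩ := mem_segment_iff_coord.mp hp'
  have s0' : 0 < s := lt_of_le_of_ne s0 fun hs => hpu (by
    subst hs; exact plane_ext (by simp [e0]) (by simp [e1]))
  have s1' : s < 1 := lt_of_le_of_ne s1 fun hs => hpv (by
    subst hs; exact plane_ext (by simp [e0]) (by simp [e1]))
  have t0' : 0 < t := lt_of_le_of_ne t0 fun hs => hpx (by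
    subst hs; exact plane_ext (by simp [f0]) (by simp [f1]))
  have t1' : t < 1 := lt_of_le_of_ne t1 fun hs => hpy (by
    subst hs; exact plane_ext (by simp [f0]) (by simp [f1]))
  have hsum : (1 - t) * cross u v x + t * cross u v y = 0 := by
    have : (1 - t) * cross u v x + t * cross u v y = cross u v p := by
      unfold cross; rw [f0, f1]; ring
    rw [this]; unfold cross; rw [e0, e1]; ring
  -- Collinear case: neither side contains a point of `S` in its interior, so overlapping sides
  -- coincide.
  by_cases hx0 : cross u v x = 0
  · have hy0 : cross u v y = 0 := by
      rw [hx0] at hsum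
      simpa [t0'.ne'] using hsum
    obtain ⟨a, a0, a1⟩ := exists_param_of_cross_eq_zero h.ne hx0
    obtain ⟨b, b0, b1⟩ := exists_param_of_cross_eq_zero h.ne hy0
    have hmid : s = a + t * (b - a) := by
      have hA := sqDist_pos h.ne
      have : (s - (a + t * (b - a))) * sqDist u v = 0 := by
        have k0 : (s - (a + t * (b - a))) * (v 0 - u 0) = 0 := by
          rw [a0, b0] at f0; linear_combination f0 - e0
        have k1 : (s - (a + t * (b - a))) * (v 1 - u 1) = 0 := by
          rw [a1, b1] at f1; linear_combination f1 - e1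
        unfold sqDist
        linear_combination (v 0 - u 0) * k0 + (v 1 - u 1) * k1
      rcases mul_eq_zero.mp this with h0 | h0
      · linarith
      · exact absurd h0 hA.ne'
    have out : ∀ c : ℝ, ∀ q ∈ S, q 0 = u 0 + c * (v 0 - u 0) → q 1 = u 1 + c * (v 1 - u 1) →
        c ≤ 0 ∨ 1 ≤ c := by
      intro c q hq q0 q1
      by_contra! hc
      rcases h.eq_or_eq_of_mem_segment hq
        (mem_segment_iff_coord.mpr ⟨c, hc.1.le, hc.2.le, q0, q1⟩) with rfl | rfl
      · have hA := sqDist_pos h.ne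
        unfold sqDist at hA
        have k0 : c * (v 0 - q 0) = 0 := by linarith
        have k1 : c * (v 1 - q 1) = 0 := by linarith
        have l0 := (mul_eq_zero.mp k0).resolve_left hc.1.ne'
        have l1 := (mul_eq_zero.mp k1).resolve_left hc.1.ne'
        nlinarith
      · have hA := sqDist_pos h.ne
        unfold sqDist at hA
        have k0 : (1 - c) * (q 0 - u 0) = 0 := by linarith
        have k1 : (1 - c) * (q 1 - u 1) = 0 := by linarith
        have l0 := (mul_eq_zero.mp k0).resolve_left (by linarith [hc.2])
        have l1 := (mul_eq_zero.mp k1).resolve_left (by linarith [hc.2])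
        nlinarith
    have between : ∀ c : ℝ, ∀ q ∈ S, q 0 = u 0 + c * (v 0 - u 0) → q 1 = u 1 + c * (v 1 - u 1) →
        (a ≤ c ∧ c ≤ b ∨ b ≤ c ∧ c ≤ a) → a ≠ b → q = x ∨ q = y := by
      intro c q hq q0 q1 hc hab
      have hba : b - a ≠ 0 := sub_ne_zero.mpr hab.symm
      refine h'.eq_or_eq_of_mem_segment hq
        (mem_segment_iff_coord.mpr ⟨(c - a) / (b - a), ?_, ?_, ?_, ?_⟩)
      · rcases hc with hc | hc
        · exact div_nonneg (by linarith) (by linarith)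
        · exact div_nonneg_of_nonpos (by linarith) (by linarith)
      · rcases hc with hc | hc
        · exact div_le_one_of_le₀ (by linarith) (by linarith)
        · exact div_le_one_of_ge (by linarith) (by linarith)
      · rw [q0, a0, b0]; field_simp; ring
      · rw [q1, a1, b1]; field_simp; ring
    have hcase : (a ≤ 0 ∧ 1 ≤ b) ∨ (b ≤ 0 ∧ 1 ≤ a) := by
      rcases out a x h'.mem_left a0 a1 with ha | ha <;>
        rcases out b y h'.mem_right b0 b1 with hb | hb
      · exfalso; nlinarith
      · exact .inl ⟨ha, hb⟩
      · exact .inr ⟨hb, ha⟩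
      · exfalso; nlinarith
    have hab : a ≠ b := by rintro rfl; rcases hcase with hc | hc <;> linarith
    have hu := between 0 u h.mem_left (by ring) (by ring)
      (by rcases hcase with hc | hc
          · left; constructor <;> linarith
          · right; constructor <;> linarith) hab
    have hv := between 1 v h.mem_right (by ring) (by ring)
      (by rcases hcase with hc | hc
          · left; constructor <;> linarith
          · right; constructor <;> linarith) hab
    rcases hu with rfl | rfl <;> rcases hv with rfl | rfl
    · exact h.ne rfl
    · exact hne rfl
    · exact hne Sym2.eq_swap
    · exact h.ne rfl
  · have hy0 : cross u v y ≠ 0 := by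
      intro hy0
      rw [hy0] at hsum
      have : (1 - t) * cross u v x = 0 := by linarith
      exact hx0 ((mul_eq_zero.mp this).resolve_left (by linarith))
    have hX := h.sq_cross_le h.mem_left h.mem_right h'.mem_left hx0
    have hY := h.sq_cross_le h.mem_left h.mem_right h'.mem_right hy0
    have hsign : cross u v x * cross u v y ≤ 0 := by
      by_contra! hpos
      have : ((1 - t) * cross u v x + t * cross u v y) * cross u v x = 0 := by rw [hsum, zero_mul]
      have h3 : 0 ≤ (1 - t) * cross u v x ^ 2 := by
        have : 0 ≤ 1 - t := by linarith
        positivity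
      nlinarith [mul_pos t0' hpos]
    -- Cauchy–Schwarz, via Lagrange's identity.
    have hk : (cross u v y - cross u v x) ^ 2 ≤ sqDist u v * sqDist x y := by
      have : sqDist u v * sqDist x y - (cross u v y - cross u v x) ^ 2 =
          ((v 0 - u 0) * (y 0 - x 0) + (v 1 - u 1) * (y 1 - x 1)) ^ 2 := by
        unfold sqDist cross; ring
      linarith [sq_nonneg ((v 0 - u 0) * (y 0 - x 0) + (v 1 - u 1) * (y 1 - x 1))]
    -- `x` and `y` lie on opposite sides of `uv`, so their cross values differ by at least `2D`.
    have h4 : 4 * cross u v w ^ 2 ≤ (cross u v y - cross u v x) ^ 2 := by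
      have hXY : cross u v w ^ 2 ≤ -(cross u v x * cross u v y) := by
        have := mul_le_mul (sq_le_sq.mp hX) (sq_le_sq.mp hY) (abs_nonneg _) (abs_nonneg _)
        rwa [abs_mul_abs_self, ← sq, ← abs_mul, abs_of_nonpos hsign] at this
      have e : (cross u v y - cross u v x) ^ 2 =
        cross u v x ^ 2 + cross u v y ^ 2 - 2 * (cross u v x * cross u v y) := by ring
      linarith
    have hD : 0 < cross u v w ^ 2 := by have := h.cross_ne; positivity
    have i1 := h.three_mul_sq_sqDist_le
    have i2 := h'.three_mul_sq_sqDist_le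
    rw [← h.sq_cross_eq h'] at i2
    -- The product of the squared lengths is at most `4D² / 3`, but `hk` and `h4` make it at least
    -- `4D²`.
    linarith [two_mul_le_add_sq (sqDist u v) (sqDist x y)]

/-- Two neighbours of `u` along shortest sides that lie in the same octant around `u` coincide. -/
lemma right_eq_of_octant (h : IsShortBase S u v w) (h' : IsShortBase S u x y)
    (h0 : 0 ≤ v 0 - u 0 ↔ 0 ≤ x 0 - u 0) (h1 : 0 ≤ v 1 - u 1 ↔ 0 ≤ x 1 - u 1)
    (h2 : |v 0 - u 0| ≤ |v 1 - u 1| ↔ |x 0 - u 0| ≤ |x 1 - u 1|) : v = x := by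
  by_cases hc : cross u v x = 0
  · obtain ⟨a, a0, a1⟩ := exists_param_of_cross_eq_zero h.ne hc
    have ha : 0 < a := by
      by_contra! ha
      have hA := sqDist_pos h'.ne
      have z0 : x 0 - u 0 = 0 := by
        have e0 : x 0 - u 0 = a * (v 0 - u 0) := by linarith
        rcases le_or_gt 0 (v 0 - u 0) with hv | hv
        · have := h0.mp hv; nlinarith
        · have := not_le.mp (mt h0.mpr hv.not_ge); nlinarith
      have z1 : x 1 - u 1 = 0 := by
        have e1 : x 1 - u 1 = a * (v 1 - u 1) := by linarith
        rcases le_or_gt 0 (v 1 - u 1) with hv | hv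
        · have := h1.mp hv; nlinarith
        · have := not_le.mp (mt h1.mpr hv.not_ge); nlinarith
      unfold sqDist at hA
      nlinarith
    rcases le_total a 1 with ha1 | ha1
    · exact ((h.eq_or_eq_of_mem_segment h'.mem_right
        (mem_segment_iff_coord.mpr ⟨a, ha.le, ha1, a0, a1⟩)).resolve_left h'.ne.symm).symm
    · refine (h'.eq_or_eq_of_mem_segment h.mem_right
        (mem_segment_iff_coord.mpr ⟨a⁻¹, by positivity, inv_le_one_of_one_le₀ ha1, ?_, ?_⟩)
        ).resolve_left h.ne.symm
      · rw [a0]; field_simp; ring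
      · rw [a1]; field_simp; ring
  · exfalso
    have hC := h.sq_cross_le h.mem_left h.mem_right h'.mem_right hc
    have hD : 0 < cross u v w ^ 2 := by have := h.cross_ne; positivity
    have i1 := h.three_mul_sq_sqDist_le
    have i2 := h'.three_mul_sq_sqDist_le
    rw [← h.sq_cross_eq h'] at i2
    have hk : 2 * cross u v x ^ 2 ≤ sqDist u v * sqDist u x := by
      have e1 : sqDist u v = (v 0 - u 0) ^ 2 + (v 1 - u 1) ^ 2 := by unfold sqDist; ring
      have e2 : sqDist u x = (x 0 - u 0) ^ 2 + (x 1 - u 1) ^ 2 := by unfold sqDist; ring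
      rw [e1, e2]
      unfold cross
      exact two_mul_sq_le_of_octant h0 h1 h2
    -- Here `2D² ≤ 4D² / 3`.
    linarith [two_mul_le_add_sq (sqDist u v) (sqDist u x)]

/-- On each side of a shortest side there is at most one apex. -/
lemma apex_eq (h : IsShortBase S u v w) (h' : IsShortBase S u v x)
    (hs : 0 < cross u v w ↔ 0 < cross u v x) : w = x := by
  have heq : cross u v w = cross u v x := by
    rcases abs_eq_abs.mp (h.abs_cross_eq h') with he | he
    · exact he
    · exfalso
      rcases lt_or_gt_of_ne h.cross_ne with hl | hl
      · exact absurd (hs.mpr (by linarith)) (by linarith)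
      · exact absurd (hs.mp hl) (by linarith)
  by_contra hwx
  have hA := sqDist_pos h.ne
  -- Equal heights make `wx` parallel to `uv`; `b` is its signed length in units of `uv`. Both
  -- apexes project strictly inside `uv`, so `|b| < 1`, and `u`, `w`, `x` span `|b|` times the
  -- minimum area.
  set b := (dot u v x - dot u v w) / sqDist u v with hb
  have hbA : b * sqDist u v = dot u v x - dot u v w := div_mul_cancel₀ _ hA.ne'
  have hc : cross u w x = -b * cross u v w := by
    refine mul_right_cancel₀ hA.ne' ?_
    have : -b * cross u v w * sqDist u v = -(dot u v x - dot u v w) * cross u v w := by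
      rw [← hbA]; ring
    rw [this]
    unfold cross at heq ⊢
    unfold dot sqDist
    linear_combination (-((v 0 - u 0) * (w 0 - u 0) + (v 1 - u 1) * (w 1 - u 1))) * heq
  have hlt : |b| < 1 := by
    rw [hb, abs_div, abs_of_pos hA, div_lt_one hA, abs_lt]
    constructor <;> linarith [h.dot_left, h.dot_lt, h'.dot_left, h'.dot_lt]
  by_cases hb0 : b = 0
  · rw [hb0, zero_mul] at hbA
    refine hwx (plane_ext ?_ ?_)
    · refine mul_right_cancel₀ hA.ne' ?_
      unfold dot at hbA
      unfold cross at heq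
      unfold sqDist
      linear_combination (v 0 - u 0) * hbA - (v 1 - u 1) * heq
    · refine mul_right_cancel₀ hA.ne' ?_
      unfold dot at hbA
      unfold cross at heq
      unfold sqDist
      linear_combination (v 1 - u 1) * hbA + (v 0 - u 0) * heq
  · have hm := h.min u h.mem_left w h.mem_apex x h'.mem_apex
      (by rw [hc]; exact mul_ne_zero (neg_ne_zero.mpr hb0) h.cross_ne)
    rw [hc, abs_mul, abs_neg] at hm
    have hp := abs_pos.mpr h.cross_ne
    nlinarith

end IsShortBase

/-! ### Upper bound: labelling triangles -/

lemma exists_isShortBase {S V : Finset Plane} (hV : V ∈ acuteMinTriangles S) :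
    ∃ u v w, IsShortBase S u v w ∧ (V : Set Plane) = {u, v, w} := by
  obtain ⟨t, ht, hVt⟩ := hV
  let P : Finset (Fin 3 × Fin 3) := Finset.univ.filter fun a => a.1 ≠ a.2
  obtain ⟨⟨i, j⟩, hij, hmin⟩ := P.exists_min_image
    (fun a => dist (t.points a.1) (t.points a.2)) ⟨(0, 1), by simp [P]⟩
  have hij' : i ≠ j := by simpa [P] using hij
  have hk : ∀ i j : Fin 3, i ≠ j → ∃ k, i ≠ k ∧ j ≠ k ∧ ∀ l, l = i ∨ l = j ∨ l = k := by decide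
  obtain ⟨k, hik, hjk, hall⟩ := hk i j hij'
  refine ⟨_, _, _, ht.isShortBase hij' hik hjk fun a b hab => hmin (a, b) (by simpa [P] using hab),
    ?_⟩
  rw [hVt]
  ext q
  simp only [Set.mem_range, Set.mem_insert_iff, Set.mem_singleton_iff]
  constructor
  · rintro ⟨l, rfl⟩
    rcases hall l with rfl | rfl | rfl <;> simp
  · rintro (rfl | rfl | rfl) <;> exact ⟨_, rfl⟩

/-- Supplies finiteness: `Set.ncard` is 0 on infinite sets, which would spoil the lower bound. -/
lemma acuteMinTriangles_subset (S : Finset Plane) :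
    acuteMinTriangles S ⊆ (S.powerset : Set (Finset Plane)) := by
  rintro V ⟨t, ht, hV⟩
  rw [Finset.mem_coe, Finset.mem_powerset]
  intro p hp
  have : p ∈ Set.range t.points := hV ▸ Finset.mem_coe.mpr hp
  obtain ⟨i, rfl⟩ := this
  exact ht.1 i

lemma ncard_acuteMinTriangles_le (S : Finset Plane) : (acuteMinTriangles S).ncard ≤ 16 * S.card := by
  classical
  choose! u v w hb hV using fun V => @exists_isShortBase S V
  -- Three bits give the octant of `v` around `u`, the fourth the side of the apex.
  let f : Finset Plane → Plane × Bool × Bool × Bool × Bool := fun V =>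
    (u V, decide (0 ≤ v V 0 - u V 0), decide (0 ≤ v V 1 - u V 1),
      decide (|v V 0 - u V 0| ≤ |v V 1 - u V 1|), decide (0 < cross (u V) (v V) (w V)))
  let T : Finset (Plane × Bool × Bool × Bool × Bool) := S ×ˢ Finset.univ
  have hcard : (T : Set (Plane × Bool × Bool × Bool × Bool)).ncard = 16 * S.card := by
    rw [Set.ncard_coe_finset, Finset.card_product, mul_comm]
    rfl
  rw [← hcard]
  refine Set.ncard_le_ncard_of_injOn f ?_ ?_ (Finset.finite_toSet _)
  · intro V hVm
    simp only [f, T, Finset.mem_coe, Finset.mem_product, Finset.mem_univ, and_true]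
    exact (hb V hVm).mem_left
  · intro V hVm W hWm hf
    simp only [f, Prod.mk.injEq, decide_eq_decide] at hf
    obtain ⟨hu, h0, h1, h2, hs⟩ := hf
    have b1 := hb V hVm
    have b2 := hb W hWm
    have e1 := hV V hVm
    have e2 := hV W hWm
    rw [← hu] at h0 h1 h2 hs b2 e2
    have hv := b1.right_eq_of_octant b2 h0 h1 h2
    rw [← hv] at hs b2 e2
    have hw := b1.apex_eq b2 hs
    rw [← hw] at e2
    exact Finset.coe_injective (e1.trans e2.symm)

/-! ### Planarity of the graph -/

lemma exists_isShortBase_of_adj {S : Finset Plane} {u v : S} (h : (shortestSideGraph S).Adj u v) :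
    ∃ w, IsShortBase S u v w := by
  obtain ⟨hne, t, ht, ⟨i, hi⟩, ⟨j, hj⟩, hmin⟩ := h
  have hij : i ≠ j := by
    rintro rfl
    exact hne (Subtype.ext (hi.symm.trans hj))
  have hk : ∀ i j : Fin 3, i ≠ j → ∃ k, i ≠ k ∧ j ≠ k := by decide
  obtain ⟨k, hik, hjk⟩ := hk i j hij
  rw [← hi, ← hj] at hmin ⊢
  exact ⟨_, ht.isShortBase hij hik hjk hmin⟩

lemma isPlanarStraightLineGraph_shortestSideGraph (S : Finset Plane) :
    IsPlanarStraightLineGraph (shortestSideGraph S) := by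
  constructor
  · intro u v x huv hx
    obtain ⟨w, hw⟩ := exists_isShortBase_of_adj huv
    exact (hw.eq_or_eq_of_mem_segment x.2 hx).imp Subtype.ext Subtype.ext
  · rintro u v x y huv hxy hne p ⟨hp, hp'⟩
    obtain ⟨w, hw⟩ := exists_isShortBase_of_adj huv
    obtain ⟨z, hz⟩ := exists_isShortBase_of_adj hxy
    have hne' : s((u : Plane), (v : Plane)) ≠ s((x : Plane), (y : Plane)) := by
      intro he
      apply hne
      rw [Sym2.eq_iff] at he ⊢
      simpa only [Subtype.ext_iff] using he
    have hpS : p ∈ S := by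
      rcases hw.endpoint_of_mem_inter hz hne' hp hp' with rfl | rfl | rfl | rfl <;>
        exact Subtype.property _
    exact ⟨hw.eq_or_eq_of_mem_segment hpS hp, hz.eq_or_eq_of_mem_segment hpS hp'⟩

/-! ### Lower bound: the zigzag -/

/-- The points of a zigzag on two horizontal lattice lines at distance two. -/
noncomputable def zigzag (k : ℕ) : Plane := !₂[(k : ℝ), 2 * ((k % 2 : ℕ) : ℝ)]

lemma zigzag_injective : Function.Injective zigzag := by
  intro a b h
  have h0 : zigzag a 0 = zigzag b 0 := by rw [h]
  simp only [zigzag, PiLp.toLp_apply, Matrix.cons_val_zero] at h0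
  exact_mod_cast h0

/-- All points lie in the lattice spanned by `(2, 0)` and `(1, 2)`, with coordinates `k / 2` and `k
% 2`; its determinant is 4. -/
lemma four_le_abs_cross_zigzag {i j k : ℕ} (h : cross (zigzag i) (zigzag j) (zigzag k) ≠ 0) :
    4 ≤ |cross (zigzag i) (zigzag j) (zigzag k)| := by
  have hdiv : ∃ m : ℤ, cross (zigzag i) (zigzag j) (zigzag k) = 4 * m := by
    have hi : (i : ℝ) = 2 * ((i / 2 : ℕ) : ℝ) + ((i % 2 : ℕ) : ℝ) := by
      exact_mod_cast (Nat.div_add_mod i 2).symm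
    have hj : (j : ℝ) = 2 * ((j / 2 : ℕ) : ℝ) + ((j % 2 : ℕ) : ℝ) := by
      exact_mod_cast (Nat.div_add_mod j 2).symm
    have hk : (k : ℝ) = 2 * ((k / 2 : ℕ) : ℝ) + ((k % 2 : ℕ) : ℝ) := by
      exact_mod_cast (Nat.div_add_mod k 2).symm
    refine ⟨((j / 2 : ℕ) - (i / 2 : ℕ) : ℤ) * ((k % 2 : ℕ) - (i % 2 : ℕ) : ℤ) -
      ((k / 2 : ℕ) - (i / 2 : ℕ) : ℤ) * ((j % 2 : ℕ) - (i % 2 : ℕ) : ℤ), ?_⟩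
    simp only [cross, zigzag, PiLp.toLp_apply, Matrix.cons_val_zero, Matrix.cons_val_one,
      Int.cast_sub, Int.cast_mul, Int.cast_natCast]
    linear_combination 2 * (((k % 2 : ℕ) : ℝ) - ((i % 2 : ℕ) : ℝ)) * (hj - hi) -
      2 * (((j % 2 : ℕ) : ℝ) - ((i % 2 : ℕ) : ℝ)) * (hk - hi)
  obtain ⟨m, hm⟩ := hdiv
  rw [hm] at h ⊢
  have hm0 : m ≠ 0 := by rintro rfl; simp at h
  have : (1 : ℝ) ≤ |(m : ℝ)| := by exact_mod_cast Int.one_le_abs hm0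
  rw [abs_mul, abs_of_pos (by norm_num : (0 : ℝ) < 4)]
  linarith

lemma zigzag_consecutive (k : ℕ) :
    |cross (zigzag k) (zigzag (k + 1)) (zigzag (k + 2))| = 4 ∧
    0 < dot (zigzag k) (zigzag (k + 1)) (zigzag (k + 2)) ∧
    0 < dot (zigzag (k + 1)) (zigzag k) (zigzag (k + 2)) ∧
    0 < dot (zigzag (k + 2)) (zigzag k) (zigzag (k + 1)) := by
  simp only [cross, dot, zigzag, PiLp.toLp_apply, Matrix.cons_val_zero, Matrix.cons_val_one]
  rcases Nat.mod_two_eq_zero_or_one k with h | h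
  · have h1 : (k + 1) % 2 = 1 := by omega
    have h2 : (k + 2) % 2 = 0 := by omega
    rw [h, h1, h2]
    push_cast
    ring_nf
    norm_num
  · have h1 : (k + 1) % 2 = 0 := by omega
    have h2 : (k + 2) % 2 = 1 := by omega
    rw [h, h1, h2]
    push_cast
    ring_nf
    norm_num

lemma zigzag_mem_acuteMinTriangles [DecidableEq Plane] {n k : ℕ} (hk : k + 2 < n) :
    ({zigzag k, zigzag (k + 1), zigzag (k + 2)} : Finset Plane) ∈
      acuteMinTriangles ((Finset.range n).image zigzag) := by
  obtain ⟨hc, d0, d1, d2⟩ := zigzag_consecutive k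
  have hne : cross (zigzag k) (zigzag (k + 1)) (zigzag (k + 2)) ≠ 0 := by
    rw [← abs_pos, hc]; norm_num
  have hmem : ∀ i < n, zigzag i ∈ (Finset.range n).image zigzag := fun i hi =>
    Finset.mem_image_of_mem _ (Finset.mem_range.mpr hi)
  refine ⟨⟨![zigzag k, zigzag (k + 1), zigzag (k + 2)],
    affineIndependent_iff_cross_ne_zero.mpr hne⟩, ⟨?_, ?_, ?_⟩, ?_⟩
  · intro i
    fin_cases i
    · exact hmem _ (by omega)
    · exact hmem _ (by omega)
    · exact hmem _ (by omega)
  · rw [Affine.Triangle.acuteAngled_iff_angle_lt]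
    refine ⟨angle_lt_pi_div_two_iff_dot.mpr d1, ?_, angle_lt_pi_div_two_iff_dot.mpr ?_⟩
    · rw [EuclideanGeometry.angle_comm]
      exact angle_lt_pi_div_two_iff_dot.mpr d2
    · have : dot (zigzag k) (zigzag (k + 2)) (zigzag (k + 1)) =
          dot (zigzag k) (zigzag (k + 1)) (zigzag (k + 2)) := by unfold dot; ring
      exact this ▸ d0
  · intro t' ht'
    have h1 := abs_cross_points ⟨![zigzag k, zigzag (k + 1), zigzag (k + 2)],
      affineIndependent_iff_cross_ne_zero.mpr hne⟩
      (i := 0) (j := 1) (k := 2) (by decide) (by decide) (by decide)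
    have h2 := abs_cross_points t' (i := 0) (j := 1) (k := 2) (by decide) (by decide) (by decide)
    change |cross (zigzag k) (zigzag (k + 1)) (zigzag (k + 2))| = _ at h1
    obtain ⟨a, -, ha⟩ := Finset.mem_image.mp (ht' 0)
    obtain ⟨b, -, hb⟩ := Finset.mem_image.mp (ht' 1)
    obtain ⟨c, -, hc'⟩ := Finset.mem_image.mp (ht' 2)
    have hpos := triangleArea_pos t'
    rw [← ha, ← hb, ← hc'] at h2
    have := four_le_abs_cross_zigzag (i := a) (j := b) (k := c)
      (by rw [← abs_pos, h2]; linarith)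
    linarith
  · rw [Finset.coe_insert, Finset.coe_insert, Finset.coe_singleton]
    ext q
    constructor
    · rintro (rfl | rfl | rfl)
      · exact ⟨0, rfl⟩
      · exact ⟨1, rfl⟩
      · exact ⟨2, rfl⟩
    · rintro ⟨i, rfl⟩
      fin_cases i <;> simp

lemma le_ncard_acuteMinTriangles_zigzag [DecidableEq Plane] (n : ℕ) :
    n - 2 ≤ (acuteMinTriangles ((Finset.range n).image zigzag)).ncard := by
  have hr : ((Finset.range (n - 2) : Finset ℕ) : Set ℕ).ncard = n - 2 := by
    rw [Set.ncard_coe_finset, Finset.card_range]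
  conv_lhs => rw [← hr]
  refine Set.ncard_le_ncard_of_injOn
    (fun k => ({zigzag k, zigzag (k + 1), zigzag (k + 2)} : Finset Plane)) ?_ ?_
    ((Finset.finite_toSet _).subset (acuteMinTriangles_subset _))
  · intro k hk
    exact zigzag_mem_acuteMinTriangles (by simp at hk; omega)
  · intro k _ l _ h
    have h' : ({zigzag k, zigzag (k + 1), zigzag (k + 2)} : Finset Plane) =
      {zigzag l, zigzag (l + 1), zigzag (l + 2)} := h
    have h1 : zigzag k ∈ ({zigzag l, zigzag (l + 1), zigzag (l + 2)} : Finset Plane) := by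
      rw [← h']; simp
    have h2 : zigzag l ∈ ({zigzag k, zigzag (k + 1), zigzag (k + 2)} : Finset Plane) := by
      rw [h']; simp
    simp only [Finset.mem_insert, Finset.mem_singleton, zigzag_injective.eq_iff] at h1 h2
    omega

theorem theorem4 :
    (∃ C : ℝ, ∀ S : Finset Plane, ((acuteMinTriangles S).ncard : ℝ) ≤ C * S.card) ∧
    (∃ c : ℝ, 0 < c ∧ ∀ n : ℕ, 3 ≤ n →
      ∃ S : Finset Plane, S.card = n ∧ c * n ≤ ((acuteMinTriangles S).ncard : ℝ)) ∧
    ∀ S : Finset Plane, IsPlanarStraightLineGraph (shortestSideGraph S) := by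
  classical
  refine ⟨⟨16, fun S => ?_⟩, ⟨1 / 3, by norm_num, fun n hn => ?_⟩,
    isPlanarStraightLineGraph_shortestSideGraph⟩
  · exact_mod_cast ncard_acuteMinTriangles_le S
  · refine ⟨(Finset.range n).image zigzag, ?_, ?_⟩
    · rw [Finset.card_image_of_injective _ zigzag_injective, Finset.card_range]
    · have h := le_ncard_acuteMinTriangles_zigzag n
      -- `n - 2 ≥ n / 3` exactly when `n ≥ 3`.
      have h3 : n ≤ 3 * (acuteMinTriangles ((Finset.range n).image zigzag)).ncard := by omega
      have h4 : (n : ℝ) ≤ 3 * ((acuteMinTriangles ((Finset.range n).image zigzag)).ncard : ℝ) := by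
        exact_mod_cast h3
      linarith
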